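/- Let $n \ge 2$, let $B(l_1^n) = \{x \in \mathbb{R}^n : \sum_{i=1}^n |x_i| \le 1\}$ be the cross-polytope, and for a unit vector $a \in S^{n-1} \subset \mathbb{R}^n$ and $t \in \mathbb{R}$ let $$P(a,t) := \mathrm{vol}_{n-2}\big(\{x \in \partial B(l_1^n) : \langle a, x\rangle = t\}\big)$$ be its perimeter function, where $\partial B(l_1^n)$ is the topological boundary and $\mathrm{vol}_{n-2}$ is the $(n-2)$-dimensional Euclidean volume (normalized Hausdorff measure; the number of points if $n=2$). Let $e_1 = (1,0,\ldots,0)$. Then $P(e_1,0)$ is finite, and for every $a \in S^{n-1}$ $$P(a,0) \le \sqrt{\frac{n}{n-1}}\; P(e_1,0) .$$ -/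

import Mathlib

open MeasureTheory
open scoped ENNReal

/-- The hyperplane `H_t(a) = {x ∈ ℝⁿ | ⟨a, x⟩ = t}`. -/
def sectionHyperplane {n : ℕ} (a : EuclideanSpace ℝ (Fin n)) (t : ℝ) :
    Set (EuclideanSpace ℝ (Fin n)) :=
  {x | inner ℝ a x = t}

/-- The perimeter function `P_K(a, t) = vol_{n-2}(H_t(a) ∩ ∂K)`, where `∂K` is the topological
boundary of `K` and `vol_{n-2}` is the `(n-2)`-dimensional Euclidean volume in `ℝⁿ`: the Hausdorff
measure normalized so as to agree with Lebesgue measure on `(n-2)`-dimensional Euclidean spaces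
(counting measure if `n = 2`). It is meant for `n ≥ 2`. -/
noncomputable def perimeter {n : ℕ} (K : Set (EuclideanSpace ℝ (Fin n)))
    (a : EuclideanSpace ℝ (Fin n)) (t : ℝ) : ℝ≥0∞ :=
  Measure.euclideanHausdorffMeasure (n - 2) (sectionHyperplane a t ∩ frontier K)

/-- The cross-polytope `B(l_1^n) = {x ∈ ℝⁿ | ∑ |x_i| ≤ 1}`. -/
def crossPolytope (n : ℕ) : Set (EuclideanSpace ℝ (Fin n)) :=
  {x | ∑ i, |x i| ≤ 1}

open scoped Pointwise

/-! Write `n = m + 2`. The section splits over the orthants into flat pieces `sectionFacet a ε`,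
lying in `⟨a, y⟩ = 0`, `⟨v, y⟩ = 1`, where `v` is the projection to `a^⊥` of the sign vector `ε`.
When `v ≠ 0`, integrating `exp (-⟨v, x⟩) g(⟨a, x⟩)` over the cylinder above such a piece gives its
volume times `m! ‖v‖⁻¹ ∫ g` (`lintegral_cone`), and `‖v‖² = n - ⟨a, ε⟩² ≤ n`.

For the upper bound, `g(t) = exp (-‖a‖₁|t|) · 2d/(d² + t²)`. The triangle inequality bounds the
integrand by `exp (-‖x‖₁)` times the Cauchy kernel at `⟨a, x⟩`, whose total integral is, by Fourier
inversion, `∫ exp (-d|u|) ∏ 2/(1 + u² a_i²) du ≤ 2ⁿ π`, since `∏ (1 + u² a_i²) ≥ 1 + u²`. As `d →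
0`, this yields `P(a,0) m! 2π ≤ √n 2ⁿ π` (`perimeter_mul_le`).

For `e₁` every `‖v‖` is `√(n-1)` and `g(t) = exp (-|t|)` gives the equality `P(e₁,0) m! 2 = √(n-1)
2ⁿ` (`perimeter_single_zero_mul`). The quotient is the constant. -/

/-! ### Orthogonal coordinates and integration over cones -/

lemma exists_linearIsometry_measurePreserving {m : ℕ} {a u : EuclideanSpace ℝ (Fin (m + 2))}
    (ha : ‖a‖ = 1) (hu : ‖u‖ = 1) (hau : inner ℝ a u = 0) :
    ∃ φ : EuclideanSpace ℝ (Fin m) →ₗᵢ[ℝ] EuclideanSpace ℝ (Fin (m + 2)),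
      (∀ z, inner ℝ a (φ z) = 0) ∧ (∀ z, inner ℝ u (φ z) = 0) ∧
      (∀ x, ∃ z, x = inner ℝ a x • a + inner ℝ u x • u + φ z) ∧
      MeasurePreserving (fun p : ℝ × ℝ × EuclideanSpace ℝ (Fin m) =>
        p.1 • a + p.2.1 • u + φ p.2.2) := by
  classical
  -- Only entries 0 and 1 enter the basis extension; the zeros are fillers.
  let v : Fin (m + 2) → EuclideanSpace ℝ (Fin (m + 2)) := Fin.cons a (Fin.cons u fun _ => 0)
  have hv : Orthonormal ℝ (({0, 1} : Set (Fin (m + 2))).domRestrict v) := by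
    have h1 : v 1 = u := rfl
    have h0 : v 0 = a := rfl
    have key : ∀ i j : Fin (m + 2), i = 0 ∨ i = 1 → j = 0 ∨ j = 1 →
        inner ℝ (v i) (v j) = if i = j then (1 : ℝ) else 0 := by
      rintro i j (rfl | rfl) (rfl | rfl)
      · simp [h0, ha]
      · simp [h0, h1, hau]
      · simp [h0, h1, real_inner_comm, hau]
      · simp [h1, hu]
    rw [orthonormal_iff_ite]
    rintro ⟨i, hi⟩ ⟨j, hj⟩
    simpa [Set.domRestrict] using key i j hi hj
  obtain ⟨b, hb⟩ := hv.exists_orthonormalBasis_extension_of_card_eq (by simp)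
  have hb0 : b 0 = a := hb 0 (by simp)
  have hb1 : b 1 = u := hb 1 (by simp)
  let pad : EuclideanSpace ℝ (Fin m) →ₗᵢ[ℝ] EuclideanSpace ℝ (Fin (m + 2)) :=
    { toFun := fun z => WithLp.toLp 2 (Fin.cons 0 (Fin.cons 0 z.ofLp))
      map_add' := fun x y => by
        ext i
        refine Fin.cases ?_ (fun i => ?_) i
        · simp
        · refine Fin.cases ?_ (fun i => ?_) i <;> simp
      map_smul' := fun c y => by
        ext i
        refine Fin.cases ?_ (fun i => ?_) i
        · simp
        · refine Fin.cases ?_ (fun i => ?_) i <;> simp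
      norm_map' := fun z => by
        simp [EuclideanSpace.norm_eq, Fin.sum_univ_succ] }
  have hcons (t s : ℝ) (z : EuclideanSpace ℝ (Fin m)) :
      t • a + s • u + b.repr.symm (pad z) =
        b.repr.symm (WithLp.toLp 2 (Fin.cons t (Fin.cons s z.ofLp))) := by
    apply b.repr.injective
    rw [map_add, map_add, map_smul, map_smul, ← hb0, ← hb1, b.repr_self, b.repr_self,
      LinearIsometryEquiv.apply_symm_apply, LinearIsometryEquiv.apply_symm_apply]
    ext i
    refine Fin.cases ?_ (fun i => ?_) i
    · simp [pad]
    · refine Fin.cases ?_ (fun i => ?_) i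
      · simp [pad]
      · have h1 : i.succ.succ ≠ (1 : Fin (m + 2)) := by
          rw [← Fin.succ_zero_eq_one]; exact fun h => Fin.succ_ne_zero _ (Fin.succ_injective _ h)
        simp [pad, h1, Fin.succ_ne_zero]
  refine ⟨b.repr.symm.toLinearIsometry.comp pad, fun z => ?_, fun z => ?_, fun x => ?_, ?_⟩
  · rw [← hb0, ← b.repr_apply_apply]
    simp [pad]
  · rw [← hb1, ← b.repr_apply_apply]
    simp [pad]
  · refine ⟨WithLp.toLp 2 fun i => b.repr x i.succ.succ, ?_⟩
    simp only [LinearIsometry.coe_comp, Function.comp_apply, LinearIsometryEquiv.coe_toLinearIsometry]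
    rw [hcons]
    apply b.repr.injective
    rw [LinearIsometryEquiv.apply_symm_apply, ← hb0, ← hb1, ← b.repr_apply_apply,
      ← b.repr_apply_apply]
    ext i
    refine Fin.cases ?_ (fun i => ?_) i
    · simp
    · refine Fin.cases ?_ (fun i => ?_) i <;> simp
  · have hfun : (fun p : ℝ × ℝ × EuclideanSpace ℝ (Fin m) =>
        p.1 • a + p.2.1 • u + (b.repr.symm.toLinearIsometry.comp pad) p.2.2) =
        b.repr.symm ∘ WithLp.toLp 2 ∘ (MeasurableEquiv.piFinSuccAbove (fun _ => ℝ) 0).symm ∘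
          Prod.map id ((MeasurableEquiv.piFinSuccAbove (fun _ => ℝ) 0).symm ∘
            Prod.map id WithLp.ofLp) := by
      funext p
      simp only [LinearIsometry.coe_comp, Function.comp_apply,
        LinearIsometryEquiv.coe_toLinearIsometry]
      rw [hcons]
      simp [MeasurableEquiv.piFinSuccAbove, Fin.insertNthEquiv]
    rw [hfun]
    exact b.measurePreserving_repr_symm.comp ((PiLp.volume_preserving_toLp _).comp
      ((volume_preserving_piFinSuccAbove (fun _ => ℝ) 0).symm.comp
        ((MeasurePreserving.id volume).prod
          ((volume_preserving_piFinSuccAbove (fun _ => ℝ) 0).symm.comp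
            ((MeasurePreserving.id volume).prod (PiLp.volume_preserving_ofLp _))))))

lemma lintegral_Ioi_comp_mul_left {r : ℝ} (hr : 0 < r) {k : ℝ → ℝ≥0∞} (hk : Measurable k) :
    ∫⁻ s in Set.Ioi 0, k (r * s) = ENNReal.ofReal r⁻¹ * ∫⁻ s in Set.Ioi 0, k s := by
  rw [← lintegral_indicator measurableSet_Ioi, ← lintegral_indicator measurableSet_Ioi]
  have h : (Set.Ioi 0).indicator (fun s => k (r * s)) =
      fun s => (Set.Ioi 0).indicator k (r * s) := by
    funext s
    by_cases hs : 0 < s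
    · rw [Set.indicator_of_mem (by simpa using hs), Set.indicator_of_mem (by simpa using mul_pos hr hs)]
    · rw [Set.indicator_of_notMem (by simpa using hs), Set.indicator_of_notMem]
      simpa using mul_nonpos_of_nonneg_of_nonpos hr.le (not_lt.mp hs)
  rw [h, ← lintegral_map (f := (Set.Ioi 0).indicator k) (hk.indicator measurableSet_Ioi)
    (measurable_const_mul r), Real.map_volume_mul_left hr.ne', lintegral_smul_measure,
    abs_of_pos (inv_pos.mpr hr), smul_eq_mul]

/-- Polar-type integration over the cylinder above the cone spanned by a flat set `T` of
codimension two, in terms of the Euclidean Hausdorff measure of `T`. -/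
lemma lintegral_cone {m : ℕ} {a v : EuclideanSpace ℝ (Fin (m + 2))} (ha : ‖a‖ = 1) (hv : v ≠ 0)
    (hav : inner ℝ a v = 0) {T : Set (EuclideanSpace ℝ (Fin (m + 2)))} (hT : MeasurableSet T)
    (hTa : ∀ y ∈ T, inner ℝ a y = 0) (hTv : ∀ y ∈ T, inner ℝ v y = 1) {g₁ g₂ : ℝ → ℝ≥0∞}
    (hg₁ : Measurable g₁) (hg₂ : Measurable g₂) :
    ∫⁻ x in {x | 0 < inner ℝ v x ∧ (inner ℝ v x)⁻¹ • (x - inner ℝ a x • a) ∈ T},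
        g₁ (inner ℝ v x) * g₂ (inner ℝ a x) =
      ENNReal.ofReal ‖v‖⁻¹ * Measure.euclideanHausdorffMeasure m T *
        ((∫⁻ s in Set.Ioi 0, ENNReal.ofReal (s ^ m) * g₁ s) * ∫⁻ t, g₂ t) := by
  have hr : 0 < ‖v‖ := norm_pos_iff.mpr hv
  set r := ‖v‖ with hr_def
  set u := r⁻¹ • v with hu_def
  have hvu : v = r • u := by rw [hu_def, smul_inv_smul₀ hr.ne']
  have hu : ‖u‖ = 1 := by
    rw [hu_def, norm_smul, norm_inv, Real.norm_of_nonneg hr.le, ← hr_def, inv_mul_cancel₀ hr.ne']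
  have hau : inner ℝ a u = 0 := by rw [hu_def, inner_smul_right, hav, mul_zero]
  obtain ⟨φ, hφa, hφu, hsurj, hφ⟩ := exists_linearIsometry_measurePreserving ha hu hau
  set Z : Set (EuclideanSpace ℝ (Fin m)) := {z | r⁻¹ • u + φ z ∈ T} with hZ_def
  have hZm : MeasurableSet Z :=
    hT.preimage (by fun_prop : Measurable fun z => r⁻¹ • u + φ z)
  have hTZ : T = (fun z => r⁻¹ • u + φ z) '' Z := by
    ext y
    constructor
    · intro hy
      obtain ⟨z, hz⟩ := hsurj y
      have h1 := hTv y hy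
      rw [hvu, inner_smul_left] at h1
      have h2 : inner ℝ u y = r⁻¹ := eq_inv_of_mul_eq_one_right h1
      rw [hTa y hy, h2, zero_smul, zero_add] at hz
      exact ⟨z, by rw [hZ_def, Set.mem_ofPred_eq, ← hz]; exact hy, hz.symm⟩
    · rintro ⟨z, hz, rfl⟩
      exact hz
  have hiso : Isometry fun z => r⁻¹ • u + φ z :=
    (IsometryEquiv.addLeft (r⁻¹ • u)).isometry.comp φ.isometry
  have hTvol : Measure.euclideanHausdorffMeasure m T = volume Z := by
    rw [hTZ, hiso.euclideanHausdorffMeasure_image,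
      EuclideanSpace.euclideanHausdorffMeasure_eq_volume]
  set C := {x | 0 < inner ℝ v x ∧ (inner ℝ v x)⁻¹ • (x - inner ℝ a x • a) ∈ T} with hC_def
  have hC : MeasurableSet C :=
    (measurableSet_lt measurable_const (by fun_prop : Measurable fun x => inner ℝ v x)).inter
      (hT.preimage (by fun_prop :
        Measurable fun x => (inner ℝ v x)⁻¹ • (x - inner ℝ a x • a)))
  have hfa (p : ℝ × ℝ × EuclideanSpace ℝ (Fin m)) :
      inner ℝ a (p.1 • a + p.2.1 • u + φ p.2.2) = p.1 := by
    simp [inner_add_right, inner_smul_right, ha, hau, hφa]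
  have hfv (p : ℝ × ℝ × EuclideanSpace ℝ (Fin m)) :
      inner ℝ v (p.1 • a + p.2.1 • u + φ p.2.2) = r * p.2.1 := by
    rw [hvu, inner_smul_left]
    simp [inner_add_right, inner_smul_right, hu, hφu, real_inner_comm, hau]
  have hmem (p : ℝ × ℝ × EuclideanSpace ℝ (Fin m)) :
      p.1 • a + p.2.1 • u + φ p.2.2 ∈ C ↔ 0 < p.2.1 ∧ (r * p.2.1)⁻¹ • p.2.2 ∈ Z := by
    rw [hC_def, Set.mem_ofPred_eq, hfa, hfv, mul_pos_iff_of_pos_left hr]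
    refine and_congr_right fun h => ?_
    rw [hZ_def, Set.mem_ofPred_eq, map_smul]
    have : (r * p.2.1)⁻¹ • (p.1 • a + p.2.1 • u + φ p.2.2 - p.1 • a) =
        r⁻¹ • u + (r * p.2.1)⁻¹ • φ p.2.2 := by
      rw [add_assoc, add_sub_cancel_left, smul_add, smul_smul]
      congr 2
      field_simp
    rw [this]
  set S : Set (ℝ × EuclideanSpace ℝ (Fin m)) := {q | 0 < q.1 ∧ (r * q.1)⁻¹ • q.2 ∈ Z} with hS_def
  have hS : MeasurableSet S :=
    (measurableSet_lt measurable_const measurable_fst).inter (hZm.preimage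
      (by fun_prop : Measurable fun q : ℝ × EuclideanSpace ℝ (Fin m) => (r * q.1)⁻¹ • q.2))
  have hG : Measurable (S.indicator fun q => g₁ (r * q.1)) :=
    (hg₁.comp (by fun_prop)).indicator hS
  have hF : Measurable (C.indicator fun x => g₁ (inner ℝ v x) * g₂ (inner ℝ a x)) :=
    Measurable.indicator (by fun_prop) hC
  rw [← lintegral_indicator hC, ← hφ.lintegral_comp hF]
  have hpt (p : ℝ × ℝ × EuclideanSpace ℝ (Fin m)) :
      C.indicator (fun x => g₁ (inner ℝ v x) * g₂ (inner ℝ a x))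
        (p.1 • a + p.2.1 • u + φ p.2.2) = g₂ p.1 * S.indicator (fun q => g₁ (r * q.1)) p.2 := by
    by_cases hp : p.2 ∈ S
    · rw [Set.indicator_of_mem ((hmem p).mpr hp), Set.indicator_of_mem hp, hfa, hfv, mul_comm]
    · rw [Set.indicator_of_notMem fun h => hp ((hmem p).mp h), Set.indicator_of_notMem hp,
        mul_zero]
  simp_rw [hpt]
  rw [Measure.volume_eq_prod, lintegral_prod_mul hg₂.aemeasurable hG.aemeasurable,
    Measure.volume_eq_prod, lintegral_prod _ hG.aemeasurable]
  -- At height `s` the cone is `(r * s) • Z`, with volume `(r * s) ^ m` times that of `Z`; rescaling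
  -- `s` later produces the factor `r⁻¹`.
  have hslice (s : ℝ) : ∫⁻ z, S.indicator (fun q => g₁ (r * q.1)) (s, z) =
      (Set.Ioi 0).indicator
        (fun s => volume Z * (ENNReal.ofReal ((r * s) ^ m) * g₁ (r * s))) s := by
    by_cases hs : 0 < s
    · have hrs : 0 < r * s := mul_pos hr hs
      have h : (fun z => S.indicator (fun q => g₁ (r * q.1)) (s, z)) =
          ((r * s) • Z).indicator fun _ => g₁ (r * s) := by
        funext z
        have : (s, z) ∈ S ↔ z ∈ (r * s) • Z := by
          rw [Set.mem_smul_set_iff_inv_smul_mem₀ hrs.ne', hS_def, Set.mem_ofPred_eq]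
          simp [hs]
        by_cases hz : z ∈ (r * s) • Z
        · rw [Set.indicator_of_mem hz, Set.indicator_of_mem (this.mpr hz)]
        · rw [Set.indicator_of_notMem hz, Set.indicator_of_notMem fun h => hz (this.mp h)]
      rw [h, lintegral_indicator_const (hZm.const_smul₀ _), Measure.addHaar_smul,
        Set.indicator_of_mem (by simpa using hs), abs_of_nonneg (by positivity)]
      simp only [finrank_euclideanSpace, Fintype.card_fin]
      ring
    · rw [Set.indicator_of_notMem (by simpa using hs)]
      have h (z) : (s, z) ∉ S := fun h => hs h.1
      simp [h]
  simp_rw [hslice]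
  have hk : Measurable fun s : ℝ => ENNReal.ofReal (s ^ m) * g₁ s := by fun_prop
  rw [lintegral_indicator measurableSet_Ioi, lintegral_const_mul _ (by fun_prop),
    lintegral_Ioi_comp_mul_left hr hk, hTvol]
  ring

/-! ### Exponential integrals, Fourier transforms and the Cauchy kernel -/

lemma integrable_exp_neg_mul_abs {d : ℝ} (hd : 0 < d) :
    Integrable fun x : ℝ => Real.exp (-(d * |x|)) := by
  rw [← integrableOn_univ, ← Set.Iic_union_Ioi (a := (0 : ℝ)), integrableOn_union]
  constructor
  · refine (integrableOn_exp_mul_Iic hd 0).congr_fun (fun x hx => ?_) measurableSet_Iic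
    simp only [abs_of_nonpos (Set.mem_Iic.mp hx), mul_neg, neg_neg]
  · refine (integrableOn_exp_mul_Ioi (neg_lt_zero.mpr hd) 0).congr_fun (fun x hx => ?_)
      measurableSet_Ioi
    simp only [abs_of_pos (Set.mem_Ioi.mp hx), neg_mul]

lemma integral_exp_neg_mul_abs_mul_cexp {d : ℝ} (hd : 0 < d) (u : ℝ) :
    ∫ x : ℝ, (Real.exp (-(d * |x|)) : ℂ) * Complex.exp (Complex.I * u * x) =
      ((2 * d / (d ^ 2 + u ^ 2) : ℝ) : ℂ) := by
  have hint : Integrable fun x : ℝ =>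
      (Real.exp (-(d * |x|)) : ℂ) * Complex.exp (Complex.I * u * x) := by
    refine (integrable_exp_neg_mul_abs hd).ofReal.mul_bdd (c := 1)
      (by fun_prop) (Filter.Eventually.of_forall fun x => ?_)
    simp [Complex.norm_exp]
  rw [← intervalIntegral.integral_Iic_add_Ioi (b := 0) hint.integrableOn hint.integrableOn,
    setIntegral_congr_fun (g := fun x : ℝ => Complex.exp ((d + Complex.I * u) * x))
      measurableSet_Iic (fun x hx => ?_),
    setIntegral_congr_fun (g := fun x : ℝ => Complex.exp ((-d + Complex.I * u) * x))
      measurableSet_Ioi (fun x hx => ?_),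
    integral_exp_mul_complex_Iic (by simpa using hd), integral_exp_mul_complex_Ioi (by simpa using hd)]
  · have h1 : (d + Complex.I * u : ℂ) ≠ 0 := fun h => hd.ne' (by simpa using congrArg Complex.re h)
    have h2 : (-d + Complex.I * u : ℂ) ≠ 0 := fun h => hd.ne' (by simpa using congrArg Complex.re h)
    have h3 : (d ^ 2 + u ^ 2 : ℂ) ≠ 0 := by exact_mod_cast (by positivity : d ^ 2 + u ^ 2 ≠ 0)
    push_cast
    simp only [mul_zero, Complex.exp_zero]
    field_simp
    ring_nf
    simp only [Complex.I_sq]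
    ring
  · simp only [abs_of_pos (Set.mem_Ioi.mp hx)]
    rw [Complex.ofReal_exp, ← Complex.exp_add]
    push_cast
    ring_nf
  · simp only [abs_of_nonpos (Set.mem_Iic.mp hx)]
    rw [Complex.ofReal_exp, ← Complex.exp_add]
    push_cast
    ring_nf

/-- Drops the terms of degree at least two. With `f i = (u * a i) ^ 2` and `‖a‖ = 1` the left side
is `1 + u ^ 2`. -/
lemma one_add_sum_le_prod_one_add {ι : Type*} (s : Finset ι) {f : ι → ℝ} (hf : ∀ i, 0 ≤ f i) :
    1 + ∑ i ∈ s, f i ≤ ∏ i ∈ s, (1 + f i) := by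
  classical
  induction s using Finset.induction_on with
  | empty => simp
  | insert i s hi ih =>
    rw [Finset.sum_insert hi, Finset.prod_insert hi]
    have h := Finset.sum_nonneg fun j (_ : j ∈ s) => hf j
    nlinarith [mul_le_mul_of_nonneg_left ih (hf i), mul_nonneg (hf i) h]

lemma integrable_exp_neg_sum_abs (ι : Type*) [Fintype ι] :
    Integrable fun x : ι → ℝ => Real.exp (-∑ i, |x i|) := by
  have h := Integrable.fintype_prod (ι := ι) (μ := fun _ => (volume : Measure ℝ))
    (f := fun _ x => Real.exp (-(1 * |x|))) fun _ => integrable_exp_neg_mul_abs one_pos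
  simpa [← Real.exp_sum, Finset.sum_neg_distrib, volume_pi] using h

/-- The Fourier transform of `exp (-‖x‖₁)`. -/
lemma integral_exp_neg_sum_abs_mul_cexp {ι : Type*} [Fintype ι] (b : ι → ℝ) :
    ∫ x : ι → ℝ, (Real.exp (-∑ i, |x i|) : ℂ) * Complex.exp (Complex.I * ∑ i, b i * x i) =
      ((∏ i, 2 / (1 + b i ^ 2) : ℝ) : ℂ) := by
  have h := integral_fintype_prod_volume_eq_prod (𝕜 := ℂ) (ι := ι) (E := fun _ => ℝ)
    fun i x => (Real.exp (-(1 * |x|)) : ℂ) * Complex.exp (Complex.I * b i * x)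
  simp only [integral_exp_neg_mul_abs_mul_cexp one_pos] at h
  push_cast at h ⊢
  simp only [mul_one, one_pow] at h
  rw [← h]
  congr 1
  funext x
  rw [Finset.prod_mul_distrib, ← Complex.exp_sum, ← Complex.exp_sum, Finset.mul_sum]
  simp [Finset.sum_neg_distrib, mul_assoc]

/-- The kernel is the Fourier transform of `exp (-d|u|)`, so Fubini turns the integral into one over
`u` of the transform of `exp (-‖x‖₁)` along the line `u a`. -/
lemma integral_exp_neg_sum_abs_mul_cauchy_le {ι : Type*} [Fintype ι] {a : ι → ℝ}
    (ha : ∑ i, a i ^ 2 = 1) {d : ℝ} (hd : 0 < d) :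
    ∫ x : ι → ℝ, Real.exp (-∑ i, |x i|) * (2 * d / (d ^ 2 + (∑ i, a i * x i) ^ 2)) ≤
      2 ^ Fintype.card ι * Real.pi := by
  have hint : Integrable (fun p : (ι → ℝ) × ℝ => (Real.exp (-∑ i, |p.1 i|) : ℂ) *
      ((Real.exp (-(d * |p.2|)) : ℂ) *
        Complex.exp (Complex.I * (∑ i, a i * p.1 i : ℝ) * p.2))) (volume.prod volume) := by
    have h := ((integrable_exp_neg_sum_abs ι).ofReal (𝕜 := ℂ)).mul_prod
      ((integrable_exp_neg_mul_abs hd).ofReal (𝕜 := ℂ))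
    simp_rw [← mul_assoc]
    refine h.mul_bdd (c := 1) (by fun_prop) (Filter.Eventually.of_forall fun p => ?_)
    simp [Complex.norm_exp]
  have key : ((∫ x : ι → ℝ, Real.exp (-∑ i, |x i|) *
        (2 * d / (d ^ 2 + (∑ i, a i * x i) ^ 2)) : ℝ) : ℂ) =
      ((∫ u : ℝ, Real.exp (-(d * |u|)) * ∏ i, 2 / (1 + (u * a i) ^ 2) : ℝ) : ℂ) := by
    rw [← integral_complex_ofReal, ← integral_complex_ofReal]
    calc _ = ∫ x : ι → ℝ, ∫ u : ℝ, (Real.exp (-∑ i, |x i|) : ℂ) *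
          ((Real.exp (-(d * |u|)) : ℂ) *
            Complex.exp (Complex.I * (∑ i, a i * x i : ℝ) * u)) := by
          congr 1
          funext x
          rw [integral_const_mul, integral_exp_neg_mul_abs_mul_cexp hd]
          simp
      _ = ∫ u : ℝ, ∫ x : ι → ℝ, (Real.exp (-∑ i, |x i|) : ℂ) *
          ((Real.exp (-(d * |u|)) : ℂ) *
            Complex.exp (Complex.I * (∑ i, a i * x i : ℝ) * u)) := integral_integral_swap hint
      _ = _ := by
          congr 1
          funext u
          have h (x : ι → ℝ) : (Real.exp (-∑ i, |x i|) : ℂ) * ((Real.exp (-(d * |u|)) : ℂ) *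
              Complex.exp (Complex.I * (∑ i, a i * x i : ℝ) * u)) =
              (Real.exp (-(d * |u|)) : ℂ) * ((Real.exp (-∑ i, |x i|) : ℂ) *
                Complex.exp (Complex.I * ∑ i, (u * a i : ℝ) * x i)) := by
            rw [mul_left_comm, mul_assoc Complex.I]
            congr 4
            push_cast
            rw [Finset.sum_mul]
            exact Finset.sum_congr rfl fun i _ => by ring
          simp_rw [h]
          rw [integral_const_mul, integral_exp_neg_sum_abs_mul_cexp]
          simp
  rw [Complex.ofReal_inj.mp key, ← integral_univ_inv_one_add_sq, ← integral_const_mul]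
  refine integral_mono_of_nonneg (Filter.Eventually.of_forall fun u => by positivity)
    (integrable_inv_one_add_sq.const_mul _) (Filter.Eventually.of_forall fun u => ?_)
  have h1 : 1 + u ^ 2 ≤ ∏ i, (1 + (u * a i) ^ 2) := by
    refine le_trans (le_of_eq ?_) (one_add_sum_le_prod_one_add _ fun i => sq_nonneg _)
    simp [mul_pow, ← Finset.mul_sum, ha]
  have h2 : ∏ i, 2 / (1 + (u * a i) ^ 2) ≤ 2 ^ Fintype.card ι * (1 + u ^ 2)⁻¹ := by
    rw [Finset.prod_div_distrib, Finset.prod_const, Finset.card_univ, div_eq_mul_inv]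
    gcongr
  have h3 : Real.exp (-(d * |u|)) ≤ 1 := Real.exp_le_one_iff.mpr (by simp; positivity)
  exact (mul_le_of_le_one_left (by positivity) h3).trans h2

lemma lintegral_exp_neg_sum_abs_mul_cauchy_le {n : ℕ} {a : EuclideanSpace ℝ (Fin n)}
    (ha : ‖a‖ = 1) {d : ℝ} (hd : 0 < d) :
    ∫⁻ x : EuclideanSpace ℝ (Fin n), ENNReal.ofReal (Real.exp (-∑ i, |x i|)) *
        ENNReal.ofReal (2 * d / (d ^ 2 + inner ℝ a x ^ 2)) ≤
      ENNReal.ofReal (2 ^ n * Real.pi) := by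
  have ha' : ∑ i, a i ^ 2 = 1 := by
    rw [← EuclideanSpace.real_norm_sq_eq, ha, one_pow]
  rw [← (PiLp.volume_preserving_toLp (Fin n)).lintegral_comp (by fun_prop)]
  have h (x : Fin n → ℝ) : ENNReal.ofReal (Real.exp (-∑ i, |x i|)) *
        ENNReal.ofReal (2 * d / (d ^ 2 + inner ℝ a (WithLp.toLp 2 x) ^ 2)) =
      ENNReal.ofReal (Real.exp (-∑ i, |x i|) * (2 * d / (d ^ 2 + (∑ i, a i * x i) ^ 2))) := by
    rw [← ENNReal.ofReal_mul (by positivity)]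
    simp [PiLp.inner_apply, mul_comm]
  simp_rw [h]
  rw [← ofReal_integral_eq_lintegral_ofReal]
  · refine ENNReal.ofReal_le_ofReal ?_
    simpa using integral_exp_neg_sum_abs_mul_cauchy_le ha' hd
  -- `2 / d` is the peak of the kernel, at `⟨a, x⟩ = 0`.
  · refine (integrable_exp_neg_sum_abs (Fin n)).mul_bdd (c := 2 / d)
      (Measurable.aestronglyMeasurable (by fun_prop)) (Filter.Eventually.of_forall fun x => ?_)
    rw [Real.norm_of_nonneg (by positivity), div_le_div_iff₀ (by positivity) hd]
    nlinarith [sq_nonneg (∑ i, a i * x i)]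
  · exact Filter.Eventually.of_forall fun x => by positivity

lemma lintegral_exp_neg_sum_abs (n : ℕ) :
    ∫⁻ x : EuclideanSpace ℝ (Fin n), ENNReal.ofReal (Real.exp (-∑ i, |x i|)) = 2 ^ n := by
  rw [← (PiLp.volume_preserving_toLp (Fin n)).lintegral_comp (by fun_prop)]
  simp only
  rw [← ofReal_integral_eq_lintegral_ofReal (integrable_exp_neg_sum_abs (Fin n))
    (Filter.Eventually.of_forall fun x => by positivity)]
  have h := integral_exp_neg_sum_abs_mul_cexp (ι := Fin n) 0
  have h' : ∫ x : Fin n → ℝ, Real.exp (-∑ i, |x i|) = 2 ^ n := by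
    apply Complex.ofReal_injective
    rw [← integral_complex_ofReal]
    simpa using h
  rw [h', ENNReal.ofReal_pow (by norm_num), ENNReal.ofReal_ofNat]

lemma lintegral_exp_neg_abs : ∫⁻ t : ℝ, ENNReal.ofReal (Real.exp (-|t|)) = 2 := by
  have hi := integrable_exp_neg_mul_abs one_pos
  have h := integral_exp_neg_mul_abs_mul_cexp one_pos 0
  simp only [one_mul] at hi h
  rw [← ofReal_integral_eq_lintegral_ofReal hi (Filter.Eventually.of_forall fun t => by positivity)]
  have h' : ∫ t : ℝ, Real.exp (-|t|) = 2 := by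
    apply Complex.ofReal_injective
    rw [← integral_complex_ofReal]
    simpa using h
  rw [h', ENNReal.ofReal_ofNat]

lemma lintegral_pow_mul_exp_neg (m : ℕ) :
    ∫⁻ s in Set.Ioi (0 : ℝ), ENNReal.ofReal (s ^ m) * ENNReal.ofReal (Real.exp (-s)) =
      m.factorial := by
  have hc := Real.GammaIntegral_convergent (s := m + 1) (by positivity)
  simp only [add_sub_cancel_right, Real.rpow_natCast] at hc
  rw [setLIntegral_congr_fun (g := fun s => ENNReal.ofReal (Real.exp (-s) * s ^ m))
    measurableSet_Ioi, ← ofReal_integral_eq_lintegral_ofReal hc]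
  · have h := Real.Gamma_eq_integral (s := m + 1) (by positivity)
    simp only [add_sub_cancel_right, Real.rpow_natCast, Real.Gamma_nat_eq_factorial] at h
    rw [← h, ENNReal.ofReal_natCast]
  · filter_upwards [self_mem_ae_restrict measurableSet_Ioi] with s hs
    have : 0 < s := hs
    positivity
  · intro s hs
    have : 0 < s := hs
    simp only
    rw [mul_comm, ENNReal.ofReal_mul (by positivity)]

/-- The Cauchy kernels are an approximate identity at the peak of `exp (-N|t|)`. -/
lemma mul_two_pi_le_of_forall_cauchy {N : ℝ} (hN : 0 ≤ N) {B R : ℝ≥0∞}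
    (h : ∀ d : ℝ, 0 < d → B * ∫⁻ t : ℝ, ENNReal.ofReal (Real.exp (-(N * |t|))) *
      ENNReal.ofReal (2 * d / (d ^ 2 + t ^ 2)) ≤ R) :
    B * ENNReal.ofReal (2 * Real.pi) ≤ R := by
  -- The integrand for `d = 1 / (k + 1)` after substituting `t = d s`. It increases with `k`, so
  -- monotone convergence applies.
  let F : ℕ → ℝ → ℝ≥0∞ := fun k s =>
    ENNReal.ofReal (Real.exp (-(N * (1 / ((k : ℝ) + 1)) * |s|)) * (2 * (1 + s ^ 2)⁻¹))
  have hF (k : ℕ) : ∫⁻ t : ℝ, ENNReal.ofReal (Real.exp (-(N * |t|))) *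
      ENNReal.ofReal (2 * (1 / ((k : ℝ) + 1)) / ((1 / ((k : ℝ) + 1)) ^ 2 + t ^ 2)) =
      ∫⁻ s, F k s := by
    set d : ℝ := 1 / ((k : ℝ) + 1) with hd_def
    have hd : 0 < d := by positivity
    have hmap := Real.smul_map_volume_mul_left hd.ne'
    conv_lhs => rw [← hmap]
    rw [lintegral_smul_measure, lintegral_map (by fun_prop) (by fun_prop), smul_eq_mul,
      ← lintegral_const_mul _ (by fun_prop)]
    congr 1
    funext s
    simp only [F]
    rw [← hd_def, ← ENNReal.ofReal_mul (by positivity), ← ENNReal.ofReal_mul (by positivity),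
      abs_of_pos hd, abs_mul, abs_of_pos hd]
    congr 1
    rw [mul_left_comm, ← mul_assoc N]
    congr 1
    field_simp
  have hlim : Filter.Tendsto (fun k => ∫⁻ s, F k s) Filter.atTop
      (nhds (∫⁻ s : ℝ, ENNReal.ofReal (2 * (1 + s ^ 2)⁻¹))) := by
    refine lintegral_tendsto_of_tendsto_of_monotone (fun k => by fun_prop)
      (Filter.Eventually.of_forall fun s => ?_) (Filter.Eventually.of_forall fun s => ?_)
    · intro k l hkl
      refine ENNReal.ofReal_le_ofReal ?_
      gcongr
    · refine ENNReal.tendsto_ofReal ?_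
      have h1 : Filter.Tendsto (fun k : ℕ => Real.exp (-(N * (1 / ((k : ℝ) + 1)) * |s|)) *
          (2 * (1 + s ^ 2)⁻¹)) Filter.atTop
          (nhds (Real.exp (-(N * 0 * |s|)) * (2 * (1 + s ^ 2)⁻¹))) :=
        ((Real.continuous_exp.tendsto _).comp
          ((tendsto_one_div_add_atTop_nhds_zero_nat.const_mul N).mul_const _).neg).mul_const _
      simpa using h1
  have hval : ∫⁻ s : ℝ, ENNReal.ofReal (2 * (1 + s ^ 2)⁻¹) = ENNReal.ofReal (2 * Real.pi) := by
    rw [← ofReal_integral_eq_lintegral_ofReal (integrable_inv_one_add_sq.const_mul 2)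
      (Filter.Eventually.of_forall fun s => by positivity), integral_const_mul,
      integral_univ_inv_one_add_sq]
  rw [hval] at hlim
  refine le_of_tendsto' (ENNReal.Tendsto.const_mul hlim (Or.inl ?_)) fun k => ?_
  · simpa using Real.pi_pos
  · rw [← hF]
    exact h _ (by positivity)

/-! ### Facets of the central section and the cylinders above them -/

lemma frontier_crossPolytope (n : ℕ) :
    frontier (crossPolytope n) = {x | ∑ i, |x i| = 1} := by
  have hf : Continuous fun x : EuclideanSpace ℝ (Fin n) => ∑ i, |x i| := by fun_prop
  refine (frontier_le_subset_eq hf continuous_const).antisymm fun x hx => ?_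
  have hx' : ∑ i, |x i| = 1 := hx
  refine ⟨subset_closure (show ∑ i, |x i| ≤ 1 from hx'.le), fun hint => ?_⟩
  -- Dilating `x` by `t > 1` leaves the polytope, so `x` is not interior.
  have hc : Filter.Tendsto (fun t : ℝ => t • x) (nhdsWithin 1 (Set.Ioi 1)) (nhds x) := by
    have : Continuous fun t : ℝ => t • x := by fun_prop
    simpa using (this.tendsto 1).mono_left nhdsWithin_le_nhds
  obtain ⟨t, ht, ht1⟩ := ((hc.eventually (mem_interior_iff_mem_nhds.mp hint)).and
    self_mem_nhdsWithin).exists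
  have ht1' : 1 < t := ht1
  have h2 : ∑ i, |(t • x) i| ≤ 1 := ht
  simp only [PiLp.smul_apply, smul_eq_mul, abs_mul, ← Finset.mul_sum, hx', mul_one] at h2
  exact absurd ((le_abs_self t).trans h2) (not_le.mpr ht1')

/-- The vector in `{-1, 1}ⁿ` encoded by a Boolean vector. -/
noncomputable def signVector {n : ℕ} (ε : Fin n → Bool) : EuclideanSpace ℝ (Fin n) :=
  WithLp.toLp 2 fun i => if ε i then 1 else -1

/-- The set of vectors whose nonnegative coordinates are those marked by `ε`. -/
def orthant {n : ℕ} (ε : Fin n → Bool) : Set (EuclideanSpace ℝ (Fin n)) :=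
  {x | ∀ i, ε i = true ↔ 0 ≤ x i}

/-- The part of the section of the boundary of the cross-polytope by `a^⊥` in an orthant. -/
def sectionFacet {n : ℕ} (a : EuclideanSpace ℝ (Fin n)) (ε : Fin n → Bool) :
    Set (EuclideanSpace ℝ (Fin n)) :=
  {y | inner ℝ a y = 0 ∧ ∑ i, |y i| = 1} ∩ orthant ε

/-- The orthogonal projection to `a^⊥` of the normal vector of a facet of the cross-polytope. -/
noncomputable def sectionNormal {n : ℕ} (a : EuclideanSpace ℝ (Fin n)) (ε : Fin n → Bool) :
    EuclideanSpace ℝ (Fin n) :=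
  signVector ε - inner ℝ a (signVector ε) • a

/-- The cylinder in direction `a` above the open cone spanned by `sectionFacet a ε`. -/
def facetCylinder {n : ℕ} (a : EuclideanSpace ℝ (Fin n)) (ε : Fin n → Bool) :
    Set (EuclideanSpace ℝ (Fin n)) :=
  {x | x - inner ℝ a x • a ≠ 0 ∧ x - inner ℝ a x • a ∈ orthant ε}

section

variable {n : ℕ} {a : EuclideanSpace ℝ (Fin n)} {ε : Fin n → Bool}

lemma inner_signVector {x : EuclideanSpace ℝ (Fin n)} (hx : x ∈ orthant ε) :
    inner ℝ (signVector ε) x = ∑ i, |x i| := by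
  rw [PiLp.inner_apply]
  refine Finset.sum_congr rfl fun i _ => ?_
  have h := hx i
  by_cases hi : ε i = true
  · simp [signVector, hi, abs_of_nonneg (h.mp hi)]
  · have : x i < 0 := not_le.mp fun hx => hi (h.mpr hx)
    simp [signVector, hi, abs_of_neg this]

lemma norm_signVector_sq : ‖signVector ε‖ ^ 2 = n := by
  rw [EuclideanSpace.real_norm_sq_eq]
  have (i : Fin n) : (signVector ε) i ^ 2 = 1 := by
    by_cases hi : ε i = true <;> simp [signVector, hi]
  simp [this]

lemma abs_signVector (i : Fin n) : |signVector ε i| = 1 := by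
  by_cases hi : ε i = true <;> simp [signVector, hi]

lemma norm_sectionNormal_sq (ha : ‖a‖ = 1) :
    ‖sectionNormal a ε‖ ^ 2 = n - inner ℝ a (signVector ε) ^ 2 := by
  rw [sectionNormal, norm_sub_sq_real, norm_signVector_sq, norm_smul, ha, inner_smul_right,
    real_inner_comm, Real.norm_eq_abs, mul_one, sq_abs]
  ring

lemma norm_sectionNormal_le (ha : ‖a‖ = 1) : ‖sectionNormal a ε‖ ≤ √n := by
  refine Real.le_sqrt_of_sq_le ?_
  rw [norm_sectionNormal_sq ha]
  linarith [sq_nonneg (inner ℝ a (signVector ε))]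

lemma inner_self_sectionNormal (ha : ‖a‖ = 1) : inner ℝ a (sectionNormal a ε) = 0 := by
  simp [sectionNormal, inner_sub_right, inner_smul_right, ha]

lemma inner_sectionNormal (x : EuclideanSpace ℝ (Fin n)) :
    inner ℝ (sectionNormal a ε) x = inner ℝ (signVector ε) (x - inner ℝ a x • a) := by
  simp only [sectionNormal, inner_sub_left, inner_sub_right, inner_smul_left, inner_smul_right]
  rw [real_inner_comm a (signVector ε)]
  simp [mul_comm]

lemma inner_sectionNormal_of_mem {x : EuclideanSpace ℝ (Fin n)} (hx : x ∈ facetCylinder a ε) :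
    inner ℝ (sectionNormal a ε) x = ∑ i, |(x - inner ℝ a x • a) i| := by
  rw [inner_sectionNormal, inner_signVector hx.2]

lemma inner_sectionNormal_eq_one {y : EuclideanSpace ℝ (Fin n)} (hy : y ∈ sectionFacet a ε) :
    inner ℝ (sectionNormal a ε) y = 1 := by
  rw [inner_sectionNormal, hy.1.1, zero_smul, sub_zero, inner_signVector hy.2, hy.1.2]

lemma smul_mem_orthant_iff {c : ℝ} (hc : 0 < c) {x : EuclideanSpace ℝ (Fin n)} :
    c • x ∈ orthant ε ↔ x ∈ orthant ε := by
  refine forall_congr' fun i => ?_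
  rw [PiLp.smul_apply, smul_eq_mul, mul_nonneg_iff_of_pos_left hc]

lemma sum_abs_pos {x : EuclideanSpace ℝ (Fin n)} (hx : x ≠ 0) : 0 < ∑ i, |x i| := by
  refine (Finset.sum_nonneg fun i _ => abs_nonneg _).lt_of_ne' fun h => hx ?_
  ext i
  have := (Finset.sum_eq_zero_iff_of_nonneg fun i _ => abs_nonneg (x i)).mp h i (Finset.mem_univ i)
  simpa using this

/-- On the cylinder `⟨v, x⟩` is the ℓ¹ norm of the projected point, so dividing by it lands on the
facet. This is the shape `lintegral_cone` requires. -/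
lemma facetCylinder_eq (ha : ‖a‖ = 1) :
    facetCylinder a ε = {x | 0 < inner ℝ (sectionNormal a ε) x ∧
      (inner ℝ (sectionNormal a ε) x)⁻¹ • (x - inner ℝ a x • a) ∈ sectionFacet a ε} := by
  ext x
  constructor
  · intro hx
    have h := inner_sectionNormal_of_mem hx
    have hpos : 0 < inner ℝ (sectionNormal a ε) x := h ▸ sum_abs_pos hx.1
    refine ⟨hpos, ⟨?_, ?_⟩, (smul_mem_orthant_iff (inv_pos.mpr hpos)).mpr hx.2⟩
    · simp [inner_smul_right, inner_sub_right, ha]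
    · simp only [PiLp.smul_apply, smul_eq_mul, abs_mul, ← Finset.mul_sum]
      rw [← h, abs_of_pos (inv_pos.mpr hpos), inv_mul_cancel₀ hpos.ne']
  · rintro ⟨hpos, hx⟩
    refine ⟨fun h => ?_, (smul_mem_orthant_iff (inv_pos.mpr hpos)).mp hx.2⟩
    rw [inner_sectionNormal, h, inner_zero_right] at hpos
    exact hpos.false

/-- Zero coordinates count as nonnegative, so the orthants partition the space exactly and no null
overlaps arise. -/
lemma eq_of_mem_orthant {ε' : Fin n → Bool} {x : EuclideanSpace ℝ (Fin n)} (h : x ∈ orthant ε)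
    (h' : x ∈ orthant ε') : ε = ε' :=
  funext fun i => Bool.eq_iff_iff.mpr ((h i).trans (h' i).symm)

lemma exists_mem_orthant (x : EuclideanSpace ℝ (Fin n)) : ∃ ε, x ∈ orthant ε :=
  ⟨fun i => decide (0 ≤ x i), fun i => by simp⟩

lemma measurableSet_orthant : MeasurableSet (orthant ε) := by
  rw [show orthant ε = ⋂ i, {x | ε i = true ↔ 0 ≤ x i} by ext; simp [orthant]]
  refine MeasurableSet.iInter fun i => ?_
  have h : MeasurableSet {x : EuclideanSpace ℝ (Fin n) | 0 ≤ x i} :=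
    measurableSet_le measurable_const (by fun_prop)
  by_cases hi : ε i = true
  · simpa [hi] using h
  · simpa [hi] using measurableSet_lt
      (by fun_prop : Measurable fun x : EuclideanSpace ℝ (Fin n) => x i) measurable_const

lemma measurableSet_sectionFacet : MeasurableSet (sectionFacet a ε) :=
  ((measurableSet_eq_fun (by fun_prop : Measurable fun y => inner ℝ a y) measurable_const).inter
    (measurableSet_eq_fun (by fun_prop : Measurable fun y : EuclideanSpace ℝ (Fin n) => ∑ i, |y i|)
      measurable_const)).inter measurableSet_orthant

lemma measurableSet_facetCylinder : MeasurableSet (facetCylinder a ε) := by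
  have h : Measurable fun x => x - inner ℝ a x • a := by fun_prop
  exact ((measurableSet_singleton 0).preimage h).compl.inter (measurableSet_orthant.preimage h)

lemma pairwise_disjoint_sectionFacet : Pairwise (Function.onFun Disjoint (sectionFacet a)) :=
  fun _ _ hne => Set.disjoint_left.mpr fun _ h h' => hne (eq_of_mem_orthant h.2 h'.2)

lemma pairwise_disjoint_facetCylinder : Pairwise (Function.onFun Disjoint (facetCylinder a)) :=
  fun _ _ hne => Set.disjoint_left.mpr fun _ h h' => hne (eq_of_mem_orthant h.2 h'.2)

lemma iUnion_sectionFacet (a : EuclideanSpace ℝ (Fin n)) :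
    sectionHyperplane a 0 ∩ frontier (crossPolytope n) = ⋃ ε, sectionFacet a ε := by
  rw [frontier_crossPolytope]
  ext y
  simp only [Set.mem_iUnion]
  constructor
  · rintro ⟨h1, h2⟩
    obtain ⟨ε, hε⟩ := exists_mem_orthant y
    exact ⟨ε, ⟨h1, h2⟩, hε⟩
  · rintro ⟨ε, ⟨h1, h2⟩, -⟩
    exact ⟨h1, h2⟩

lemma iUnion_facetCylinder (a : EuclideanSpace ℝ (Fin n)) :
    ⋃ ε, facetCylinder a ε = {x | x - inner ℝ a x • a ≠ 0} := by
  ext x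
  simp only [Set.mem_iUnion]
  constructor
  · rintro ⟨ε, h, -⟩
    exact h
  · intro h
    obtain ⟨ε, hε⟩ := exists_mem_orthant (x - inner ℝ a x • a)
    exact ⟨ε, h, hε⟩

end

/-! ### The two perimeter estimates and their comparison -/

variable {m : ℕ}

lemma perimeter_eq_sum (a : EuclideanSpace ℝ (Fin (m + 2))) :
    perimeter (crossPolytope (m + 2)) a 0 =
      ∑ ε, Measure.euclideanHausdorffMeasure m (sectionFacet a ε) := by
  rw [perimeter, iUnion_sectionFacet, Nat.add_sub_cancel,
    measure_iUnion pairwise_disjoint_sectionFacet fun _ => measurableSet_sectionFacet,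
    tsum_fintype]

lemma sum_setLIntegral_facetCylinder (a : EuclideanSpace ℝ (Fin (m + 2)))
    (f : EuclideanSpace ℝ (Fin (m + 2)) → ℝ≥0∞) :
    ∑ ε, ∫⁻ x in facetCylinder a ε, f x = ∫⁻ x in {x | x - inner ℝ a x • a ≠ 0}, f x := by
  rw [← iUnion_facetCylinder, lintegral_iUnion (fun _ => measurableSet_facetCylinder)
    pairwise_disjoint_facetCylinder, tsum_fintype]

lemma setLIntegral_facetCylinder {a : EuclideanSpace ℝ (Fin (m + 2))} (ha : ‖a‖ = 1)
    {ε : Fin (m + 2) → Bool} (hv : sectionNormal a ε ≠ 0) {g : ℝ → ℝ≥0∞} (hg : Measurable g) :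
    ∫⁻ x in facetCylinder a ε,
        ENNReal.ofReal (Real.exp (-inner ℝ (sectionNormal a ε) x)) * g (inner ℝ a x) =
      ENNReal.ofReal ‖sectionNormal a ε‖⁻¹ *
        Measure.euclideanHausdorffMeasure m (sectionFacet a ε) *
        (m.factorial * ∫⁻ t, g t) := by
  rw [facetCylinder_eq ha, lintegral_cone ha hv (inner_self_sectionNormal ha)
    measurableSet_sectionFacet (fun y hy => hy.1.1) (fun y hy => inner_sectionNormal_eq_one hy)
    (g₁ := fun s => ENNReal.ofReal (Real.exp (-s))) (by fun_prop) hg, lintegral_pow_mul_exp_neg]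

lemma perimeter_mul_le {a : EuclideanSpace ℝ (Fin (m + 2))} (ha : ‖a‖ = 1) :
    perimeter (crossPolytope (m + 2)) a 0 * (m.factorial * ENNReal.ofReal (2 * Real.pi)) ≤
      ENNReal.ofReal √((m + 2 : ℕ) : ℝ) * ENNReal.ofReal (2 ^ (m + 2) * Real.pi) := by
  rw [← mul_assoc]
  -- `N` is the ℓ¹ norm of `a`, so that `‖x‖₁ ≤ ‖x - ⟨a, x⟩ a‖₁ + N |⟨a, x⟩|`.
  refine mul_two_pi_le_of_forall_cauchy (N := ∑ i, |a i|)
    (Finset.sum_nonneg fun i _ => abs_nonneg _) fun d hd => ?_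
  set g : ℝ → ℝ≥0∞ := fun t => ENNReal.ofReal (Real.exp (-((∑ i, |a i|) * |t|))) *
    ENNReal.ofReal (2 * d / (d ^ 2 + t ^ 2)) with hg_def
  have hg : Measurable g := by fun_prop
  have hfacet (ε : Fin (m + 2) → Bool) :
      Measure.euclideanHausdorffMeasure m (sectionFacet a ε) * (m.factorial * ∫⁻ t, g t) ≤
        ENNReal.ofReal √((m + 2 : ℕ) : ℝ) * ∫⁻ x in facetCylinder a ε,
          ENNReal.ofReal (Real.exp (-∑ i, |x i|)) *
            ENNReal.ofReal (2 * d / (d ^ 2 + inner ℝ a x ^ 2)) := by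
    by_cases hv : sectionNormal a ε = 0
    -- Here the sign vector is parallel to `a`, and its facet misses `a^⊥`.
    · have hempty : sectionFacet a ε = ∅ := Set.eq_empty_of_forall_notMem fun y hy => by
        simpa [hv] using inner_sectionNormal_eq_one hy
      simp [hempty]
    · have hr : 0 < ‖sectionNormal a ε‖ := norm_pos_iff.mpr hv
      calc _ = ENNReal.ofReal ‖sectionNormal a ε‖ * ∫⁻ x in facetCylinder a ε,
            ENNReal.ofReal (Real.exp (-inner ℝ (sectionNormal a ε) x)) * g (inner ℝ a x) := by
            rw [setLIntegral_facetCylinder ha hv hg, ← mul_assoc (ENNReal.ofReal _),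
              ← mul_assoc (ENNReal.ofReal _), ← ENNReal.ofReal_mul hr.le, mul_inv_cancel₀ hr.ne', ENNReal.ofReal_one, one_mul]
        _ ≤ _ := by
            refine mul_le_mul' (ENNReal.ofReal_le_ofReal (norm_sectionNormal_le ha))
              (setLIntegral_mono' measurableSet_facetCylinder fun x hx => ?_)
            rw [hg_def, ← mul_assoc]
            refine mul_le_mul_left ?_ _
            rw [← ENNReal.ofReal_mul (by positivity), ← Real.exp_add]
            refine ENNReal.ofReal_le_ofReal (Real.exp_le_exp.mpr ?_)
            rw [inner_sectionNormal_of_mem hx, ← neg_add, neg_le_neg_iff, Finset.sum_mul,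
              ← Finset.sum_add_distrib]
            refine Finset.sum_le_sum fun i _ => ?_
            calc |x i| = |(x - inner ℝ a x • a) i + a i * inner ℝ a x| := by simp [mul_comm]
              _ ≤ _ := (abs_add_le _ _).trans_eq (by rw [abs_mul])
  calc _ = ∑ ε, Measure.euclideanHausdorffMeasure m (sectionFacet a ε) *
        (m.factorial * ∫⁻ t, g t) := by
        rw [perimeter_eq_sum, mul_assoc, Finset.sum_mul]
    _ ≤ _ := Finset.sum_le_sum fun ε _ => hfacet ε
    _ ≤ _ := by
        rw [← Finset.mul_sum, sum_setLIntegral_facetCylinder]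
        gcongr
        exact (setLIntegral_le_lintegral _ _).trans (lintegral_exp_neg_sum_abs_mul_cauchy_le ha hd)

/-- Nothing is lost for `e₁`: the ℓ¹ norm is exactly `|x 0|` plus that of the projection, so no
limiting kernel is needed. -/
lemma perimeter_single_zero_mul :
    perimeter (crossPolytope (m + 2)) (EuclideanSpace.single 0 1) 0 * (m.factorial * 2) =
      ENNReal.ofReal √((m + 1 : ℕ) : ℝ) * 2 ^ (m + 2) := by
  set e : EuclideanSpace ℝ (Fin (m + 2)) := EuclideanSpace.single 0 1 with he_def
  have he : ‖e‖ = 1 := by simp [he_def]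
  have hinner (x) : inner ℝ e x = x 0 := by simp [he_def, EuclideanSpace.inner_single_left]
  have hnorm (ε : Fin (m + 2) → Bool) : ‖sectionNormal e ε‖ = √((m + 1 : ℕ) : ℝ) := by
    rw [← Real.sqrt_sq (norm_nonneg _), norm_sectionNormal_sq he, hinner, ← sq_abs,
      abs_signVector]
    push_cast
    ring_nf
  have hr : 0 < √((m + 1 : ℕ) : ℝ) := Real.sqrt_pos.mpr (by positivity)
  have hv (ε : Fin (m + 2) → Bool) : sectionNormal e ε ≠ 0 := by
    rw [← norm_pos_iff, hnorm]
    exact hr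
  have hfacet (ε : Fin (m + 2) → Bool) :
      Measure.euclideanHausdorffMeasure m (sectionFacet e ε) * (m.factorial * 2) =
        ENNReal.ofReal √((m + 1 : ℕ) : ℝ) * ∫⁻ x in facetCylinder e ε,
          ENNReal.ofReal (Real.exp (-∑ i, |x i|)) := by
    have h := setLIntegral_facetCylinder he (hv ε)
      (g := fun t => ENNReal.ofReal (Real.exp (-|t|))) (by fun_prop)
    rw [lintegral_exp_neg_abs, hnorm] at h
    rw [setLIntegral_congr_fun (g := fun x => ENNReal.ofReal (Real.exp
      (-inner ℝ (sectionNormal e ε) x)) * ENNReal.ofReal (Real.exp (-|inner ℝ e x|)))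
      measurableSet_facetCylinder, h, ← mul_assoc (ENNReal.ofReal _),
      ← mul_assoc (ENNReal.ofReal _), ← ENNReal.ofReal_mul hr.le,
      mul_inv_cancel₀ hr.ne', ENNReal.ofReal_one, one_mul]
    intro x hx
    simp only
    rw [← ENNReal.ofReal_mul (by positivity), ← Real.exp_add, inner_sectionNormal_of_mem hx, hinner,
      Fin.sum_univ_succ, Fin.sum_univ_succ (n := m + 1)]
    simp [he_def, add_comm]
  -- The cylinders omit only the line spanned by `e`, which is null in dimension `m + 2 ≥ 2`.
  have hnull : ∀ᵐ x : EuclideanSpace ℝ (Fin (m + 2)), x - inner ℝ e x • e ≠ 0 := by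
    have h1 : volume (SetLike.coe (Submodule.span ℝ {e})) = 0 := by
      refine Measure.addHaar_submodule _ _ fun h => ?_
      have h2 := finrank_span_singleton (K := ℝ) (norm_pos_iff.mp (he.symm ▸ one_pos))
      rw [h, finrank_top, finrank_euclideanSpace_fin] at h2
      omega
    filter_upwards [measure_eq_zero_iff_ae_notMem.mp h1] with x hx h
    exact hx (Submodule.mem_span_singleton.mpr ⟨_, (sub_eq_zero.mp h).symm⟩)
  rw [perimeter_eq_sum, Finset.sum_mul, Finset.sum_congr rfl fun ε _ => hfacet ε, ← Finset.mul_sum,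
    sum_setLIntegral_facetCylinder,
    Measure.restrict_eq_self_of_ae_mem (s := {x | x - inner ℝ e x • e ≠ 0}) hnull, lintegral_exp_neg_sum_abs]

theorem proposition3p2 (n : ℕ) (hn : 2 ≤ n) :
    perimeter (crossPolytope n) (EuclideanSpace.single (⟨0, by omega⟩ : Fin n) (1 : ℝ)) 0 ≠ ∞ ∧
    ∀ a : EuclideanSpace ℝ (Fin n), ‖a‖ = 1 →
      perimeter (crossPolytope n) a 0 ≤
        ENNReal.ofReal (√((n : ℝ) / ((n : ℝ) - 1))) *
          perimeter (crossPolytope n) (EuclideanSpace.single (⟨0, by omega⟩ : Fin n) (1 : ℝ)) 0 := by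
  obtain ⟨m, rfl⟩ := Nat.exists_eq_add_of_le' hn
  have h1 := perimeter_single_zero_mul (m := m)
  change perimeter (crossPolytope (m + 2)) (EuclideanSpace.single (0 : Fin (m + 2)) 1) 0 ≠ ∞ ∧
    ∀ a : EuclideanSpace ℝ (Fin (m + 2)), ‖a‖ = 1 → perimeter (crossPolytope (m + 2)) a 0 ≤ _ *
      perimeter (crossPolytope (m + 2)) (EuclideanSpace.single (0 : Fin (m + 2)) 1) 0
  set P := perimeter (crossPolytope (m + 2)) (EuclideanSpace.single (0 : Fin (m + 2)) 1) 0
  have hP : P ≠ ∞ := by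
    intro h
    rw [h, ENNReal.top_mul (by positivity)] at h1
    exact ENNReal.mul_ne_top ENNReal.ofReal_ne_top (by finiteness) h1.symm
  refine ⟨hP, fun a ha => ?_⟩
  have h2 := perimeter_mul_le ha
  have hc0 : (m.factorial * ENNReal.ofReal (2 * Real.pi) : ℝ≥0∞) ≠ 0 := by
    have := m.factorial_ne_zero
    have := Real.pi_pos
    simp_all
  have hct : (m.factorial * ENNReal.ofReal (2 * Real.pi) : ℝ≥0∞) ≠ ∞ := by finiteness
  -- Cancelling `m! 2π` leaves an identity of constants: `h1` times `π`, with `√(n/(n-1)) √(n-1) =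
  -- √n`.
  refine (ENNReal.mul_le_mul_iff_left hc0 hct).mp (h2.trans_eq ?_)
  have hm : ((m + 2 : ℕ) : ℝ) - 1 = (m + 1 : ℕ) := by push_cast; ring
  have hsqrt : ENNReal.ofReal √(((m + 2 : ℕ) : ℝ) / (m + 1 : ℕ)) *
      ENNReal.ofReal √((m + 1 : ℕ) : ℝ) = ENNReal.ofReal √((m + 2 : ℕ) : ℝ) := by
    rw [← ENNReal.ofReal_mul (Real.sqrt_nonneg _), ← Real.sqrt_mul (by positivity), div_mul_cancel₀ _ (by positivity)]
  rw [hm]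
  calc _ = ENNReal.ofReal (√(((m + 2 : ℕ) : ℝ) / (m + 1 : ℕ))) *
        (ENNReal.ofReal √((m + 1 : ℕ) : ℝ) * 2 ^ (m + 2)) * ENNReal.ofReal Real.pi := by
        rw [← mul_assoc (ENNReal.ofReal _), hsqrt,
          ENNReal.ofReal_mul (by positivity), ENNReal.ofReal_pow (by norm_num),
          ENNReal.ofReal_ofNat, mul_assoc]
    _ = _ := by
        rw [← h1, ENNReal.ofReal_mul (by norm_num), ENNReal.ofReal_ofNat]
        ring
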